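/- Let $p$ be an odd prime. A pointed finite abelian $p$-group is a pair $(A,a)$ where $A$ is a finite abelian $p$-group and $a\in A$; two such pairs $(A,a)$, $(B,b)$ are isomorphic if there is a group isomorphism $A\to B$ taking $a$ to $b$. Let $\mathcal{A}^{\bullet}$ be a set with one representative from each isomorphism class of pointed finite abelian $p$-groups, and let $\operatorname{Sur}((B,b),(A,a))$ denote the set of surjective homomorphisms $B\to A$ taking $b$ to $a$. Let $\mu_{CL}$ be the Cohen–Lenstra measure on the set of isomorphism classes of finite abelian $p$-groups, given by $$\mu_{CL}(A)=\frac{1}{|\operatorname{Aut}(A)|}\prod_{i\ge 1}(1-p^{-i}),$$ and let $\mu$ be the measure on $\mathcal{A}^{\bullet}$ obtained by picking a random group $B$ with respect to $\mu_{CL}$ and then a uniformly random element $b\in B$: $\mu(A,a)$ is the probability that the resulting pointed group $(B,b)$ is isomorphic to $(A,a)$. Here all measures are non-negative measures defined on the full power set. If $\nu$ is a measure on $\mathcal{A}^{\bullet}$ such that for all $(A,a)\in\mathcal{A}^{\bullet}$ $$\sum_{(B,b)\in\mathcal{A}^{\bullet}}|\operatorname{Sur}((B,b),(A,a))|\,\nu(B,b)=\frac{1}{|A|},$$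 then $\nu=\mu$. -/

import Mathlib

open MeasureTheory
open scoped ENNReal

noncomputable section

/-- A finite abelian `p`-group, written multiplicatively. Every finite group, in whatever universe,
is isomorphic to one whose underlying type lies in `Type`. -/
structure FinAbPGroup (p : ℕ) : Type 1 where
  carrier : Type
  [commGroup : CommGroup carrier]
  [finite : Finite carrier]
  isPGroup : IsPGroup p carrier

namespace FinAbPGroup

attribute [instance] FinAbPGroup.commGroup FinAbPGroup.finite

/-- Two finite abelian `p`-groups are equivalent if they are isomorphic. -/
instance isoSetoid (p : ℕ) : Setoid (FinAbPGroup p) where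
  r A B := Nonempty (A.carrier ≃* B.carrier)
  iseqv :=
    { refl := fun A => ⟨MulEquiv.refl A.carrier⟩
      symm := fun ⟨e⟩ => ⟨e.symm⟩
      trans := fun ⟨e⟩ ⟨f⟩ => ⟨e.trans f⟩ }

/-- The set of isomorphism classes of finite abelian `p`-groups. -/
def IsoClass (p : ℕ) : Type 1 := Quotient (isoSetoid p)

/-- The chosen representative of an isomorphism class. -/
def IsoClass.rep {p : ℕ} (X : IsoClass p) : FinAbPGroup p := Quotient.out X

/-- Measures on isomorphism classes are defined on the full power set. -/
instance (p : ℕ) : MeasurableSpace (IsoClass p) := ⊤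

end FinAbPGroup

/-- A pointed finite abelian `p`-group: a finite abelian `p`-group with an element of it. -/
structure PointedFinAbPGroup (p : ℕ) : Type 1 extends FinAbPGroup p where
  point : carrier

namespace PointedFinAbPGroup

/-- Two pointed finite abelian `p`-groups are equivalent if there is a group isomorphism between
them that takes the point of the first to the point of the second. -/
instance isoSetoid (p : ℕ) : Setoid (PointedFinAbPGroup p) where
  r A B := ∃ e : A.carrier ≃* B.carrier, e A.point = B.point
  iseqv :=
    { refl := fun A => ⟨MulEquiv.refl A.carrier, rfl⟩
      symm := fun ⟨e, he⟩ => ⟨e.symm, by rw [← he, MulEquiv.symm_apply_apply]⟩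
      trans := fun ⟨e, he⟩ ⟨f, hf⟩ => ⟨e.trans f, by rw [MulEquiv.trans_apply, he, hf]⟩ }

/-- The set of isomorphism classes of pointed finite abelian `p`-groups. -/
def IsoClass (p : ℕ) : Type 1 := Quotient (isoSetoid p)

/-- The isomorphism class of a pointed finite abelian `p`-group. -/
def isoClass {p : ℕ} (A : PointedFinAbPGroup p) : IsoClass p := Quotient.mk (isoSetoid p) A

/-- The chosen representative of an isomorphism class. -/
def IsoClass.rep {p : ℕ} (X : IsoClass p) : PointedFinAbPGroup p := Quotient.out X

/-- Measures on isomorphism classes are defined on the full power set. -/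
instance (p : ℕ) : MeasurableSpace (IsoClass p) := ⊤

/-- `Sur B A` is the set of surjective homomorphisms from `B` to `A` that take the point of `B` to
the point of `A`. -/
def Sur {p : ℕ} (B A : PointedFinAbPGroup p) : Type :=
  {f : B.carrier →* A.carrier // Function.Surjective f ∧ f B.point = A.point}

end PointedFinAbPGroup

/-- The weight `|Aut A|⁻¹ ∏_{i ≥ 1} (1 - p ^ (-i))` of a finite abelian `p`-group `A`. -/
def cohenLenstraWeight (p : ℕ) (A : FinAbPGroup p) : ℝ :=
  (Nat.card (MulAut A.carrier) : ℝ)⁻¹ * ∏' i : ℕ, (1 - ((p : ℝ) ^ (i + 1))⁻¹)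

/-- The Cohen-Lenstra measure on isomorphism classes of finite abelian `p`-groups, which gives each
class the weight of its members. -/
def cohenLenstraMeasure (p : ℕ) : Measure (FinAbPGroup.IsoClass p) :=
  Measure.sum fun X => ENNReal.ofReal (cohenLenstraWeight p X.rep) • Measure.dirac X

/-- For a finite abelian `p`-group `B`, the law of the isomorphism class of `(B, b)` when `b` is a
uniformly random element of `B`. -/
def uniformPointing {p : ℕ} (B : FinAbPGroup p) : Measure (PointedFinAbPGroup.IsoClass p) :=
  letI : Fintype B.carrier := Fintype.ofFinite B.carrier
  ((PMF.uniformOfFintype B.carrier).map fun b =>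
    PointedFinAbPGroup.isoClass (PointedFinAbPGroup.mk B b)).toMeasure

/-- The measure on isomorphism classes of pointed finite abelian `p`-groups obtained by picking a
random group `B` from the Cohen-Lenstra measure, then a uniformly random element `b` of `B`. -/
def pointedCohenLenstraMeasure (p : ℕ) : Measure (PointedFinAbPGroup.IsoClass p) :=
  (cohenLenstraMeasure p).bind fun X => uniformPointing X.rep

/-- The `(A, a)`-moment `∑_{(B, b)} |Sur((B, b), (A, a))| ν(B, b)` of a measure `ν`, where `(B, b)`
runs over one representative of each isomorphism class. -/
def pointedMoment {p : ℕ} (ν : Measure (PointedFinAbPGroup.IsoClass p))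
    (A : PointedFinAbPGroup p) : ℝ≥0∞ :=
  ∑' Y : PointedFinAbPGroup.IsoClass p,
    (Nat.card (PointedFinAbPGroup.Sur Y.rep A) : ℝ≥0∞) * ν {Y}

end

/-! Write `c = ∏ (1 - p⁻ⁱ)` and `s Y X = |Sur(Y, X)|` for pointed groups. The moment conditions are
a linear system `∑ s Y X * ν {Y} = 1 / |X|`. Test it on the weights `u Y = 1 / (|Y| |Aut Y|)`: the
diagonal term at `X` is exactly `1 / |X|`, and the whole sum is `1 / (c |X|)` (`tsum_card_sur_div`).
So `c * u`, which is the pointed Cohen–Lenstra measure, solves the system, and relative to `u` the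
off-diagonal part is `r = 1 / c - 1` times the diagonal. For `p ≥ 3` one has `c ≥ 5/9 > 1/2`, so `r
< 1`, and a contraction argument gives uniqueness (`eq_of_tsum_eq_of_diag_dominant`). For `p = 2`,
where `c` is about `0.289`, this argument breaks down.

Forgetting points, the row sum reduces to `∑ |Sur(X, A)| / |Aut X| = 1 / c` over groups `X`
(`tsum_card_surjHom_div_card_mulAut`). This comes from sublattices of `ℤⁿ` of `p`-power index,
weighted by index to the power `-n`: their total is `∏_{i ≤ n} (1 - p⁻ⁱ)⁻¹`, grouping them by
quotient brings in `|Aut X|⁻¹`, and `n → ∞` gives the identity. -/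

/-! ### Subgroups of `p`-power index in `G × ℤ`. -/

section SubgroupZeta

/-- The sum of `[G : K]⁻ⁿ` over the subgroups `K` of `G` whose index is a power of `p`. -/
noncomputable def subgroupZeta (p : ℕ) (G : Type*) [Group G] (n : ℕ) : ℝ≥0∞ :=
  ∑' K : {K : Subgroup G // ∃ k, K.index = p ^ k}, ((K.1.index : ℝ≥0∞)⁻¹) ^ n

theorem subgroupZeta_congr (p : ℕ) {G H : Type*} [Group G] [Group H] (e : G ≃* H) (n : ℕ) :
    subgroupZeta p G n = subgroupZeta p H n := by
  have hidx (K : Subgroup G) : (e.mapSubgroup K).index = K.index := Subgroup.index_map_equiv K e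
  rw [subgroupZeta, subgroupZeta,
    ← (e.mapSubgroup.toEquiv.subtypeEquiv fun K => by
      change _ ↔ ∃ k, (e.mapSubgroup K).index = p ^ k
      rw [hidx]).tsum_eq]
  refine tsum_congr fun K => ?_
  rw [← hidx]
  rfl

/-- The subgroup of `G × ℤ` which meets `G` in `K` and is generated by `K` and a lift
of `(c, d)`. -/
def Subgroup.extendByCoset {G : Type*} [CommGroup G] (K : Subgroup G) (c : G ⧸ K) (d : ℕ) :
    Subgroup (G × Multiplicative ℤ) :=
  (Subgroup.zpowers (c, Multiplicative.ofAdd (d : ℤ))).comap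
    ((QuotientGroup.mk' K).prodMap (MonoidHom.id _))

theorem Subgroup.mem_extendByCoset {G : Type*} [CommGroup G] {K : Subgroup G} {c : G ⧸ K} {d : ℕ}
    {g : G} {z : ℤ} : (g, Multiplicative.ofAdd z) ∈ K.extendByCoset c d ↔
      ∃ m : ℤ, c ^ m = (g : G ⧸ K) ∧ m * d = z := by
  simp only [Subgroup.extendByCoset, Subgroup.mem_comap, Subgroup.mem_zpowers_iff]
  refine exists_congr fun m => ?_
  rw [Prod.ext_iff]
  refine and_congr Iff.rfl ?_
  change Multiplicative.ofAdd (d : ℤ) ^ m = Multiplicative.ofAdd z ↔ _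
  rw [← ofAdd_zsmul, smul_eq_mul, EmbeddingLike.apply_eq_iff_eq]

/-- The copy of `G` is the kernel of the second projection, so the two factors are the indices of
`K` in `K·G` and of `K·G` in `G × H`. -/
theorem Subgroup.index_prod_eq {G H : Type*} [CommGroup G] [CommGroup H] (K : Subgroup (G × H)) :
    K.index = (K.comap (MonoidHom.inl G H)).index * (K.map (MonoidHom.snd G H)).index := by
  have hr : (MonoidHom.inl G H).range = (MonoidHom.snd G H).ker := by
    ext ⟨g, h⟩
    rw [MonoidHom.mem_ker]
    simp [MonoidHom.mem_range, Prod.ext_iff, eq_comm]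
  rw [Subgroup.index_comap, Subgroup.index_map, hr,
    MonoidHom.range_eq_top_of_surjective _ Prod.snd_surjective, Subgroup.index_top, mul_one,
    ← Subgroup.relIndex_sup_right, sup_comm _ K, Subgroup.relIndex_mul_index le_sup_left]

theorem Subgroup.comap_inl_extendByCoset {G : Type*} [CommGroup G] (K : Subgroup G) (c : G ⧸ K)
    {d : ℕ} (hd : d ≠ 0) : (K.extendByCoset c d).comap (MonoidHom.inl G (Multiplicative ℤ)) = K := by
  ext g
  rw [Subgroup.mem_comap, MonoidHom.inl_apply, ← ofAdd_zero, Subgroup.mem_extendByCoset]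
  constructor
  · rintro ⟨m, h, h0⟩
    obtain rfl : m = 0 := by simpa [hd] using h0
    exact (QuotientGroup.eq_one_iff g).1 (by simpa using h.symm)
  · intro h
    exact ⟨0, by simpa using ((QuotientGroup.eq_one_iff g).2 h).symm, by simp⟩

theorem Subgroup.map_snd_extendByCoset {G : Type*} [CommGroup G] (K : Subgroup G) (c : G ⧸ K)
    (d : ℕ) : (K.extendByCoset c d).map (MonoidHom.snd G _) =
      Subgroup.zpowers (Multiplicative.ofAdd (d : ℤ)) := by
  ext z
  induction z using Multiplicative.rec with | _ z
  rw [Subgroup.mem_map, Subgroup.mem_zpowers_iff]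
  constructor
  · rintro ⟨⟨g, y⟩, h, rfl⟩
    obtain ⟨m, -, h⟩ := Subgroup.mem_extendByCoset (z := y.toAdd).1 h
    refine ⟨m, ?_⟩
    rw [← ofAdd_zsmul, smul_eq_mul, h]
    rfl
  · rintro ⟨m, h⟩
    obtain ⟨g, hg⟩ := QuotientGroup.mk_surjective (c ^ m)
    refine ⟨(g, Multiplicative.ofAdd z), Subgroup.mem_extendByCoset.2 ⟨m, hg.symm, ?_⟩, rfl⟩
    rw [← ofAdd_zsmul, smul_eq_mul] at h
    exact Multiplicative.ofAdd.injective h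

theorem index_zpowers_ofAdd (d : ℕ) :
    (Subgroup.zpowers (Multiplicative.ofAdd (d : ℤ))).index = d := by
  have := Int.index_zmultiples (d : ℤ)
  rw [Int.natAbs_natCast] at this
  exact this

theorem Subgroup.index_extendByCoset {G : Type*} [CommGroup G] (K : Subgroup G) (c : G ⧸ K)
    {d : ℕ} (hd : d ≠ 0) : (K.extendByCoset c d).index = K.index * d := by
  rw [Subgroup.index_prod_eq, Subgroup.comap_inl_extendByCoset K c hd,
    Subgroup.map_snd_extendByCoset, index_zpowers_ofAdd]

/-- The trivial subgroup is included: its index is infinite, hence `0` by convention. -/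
theorem Subgroup.eq_zpowers_ofAdd_index (H : Subgroup (Multiplicative ℤ)) :
    H = Subgroup.zpowers (Multiplicative.ofAdd (H.index : ℤ)) := by
  obtain ⟨a, ha⟩ := Int.subgroup_cyclic (Subgroup.toAddSubgroup' H)
  rw [← AddSubgroup.zmultiples_eq_closure, ← Int.zmultiples_natAbs] at ha
  have h : H = Subgroup.zpowers (Multiplicative.ofAdd (a.natAbs : ℤ)) := by
    apply Subgroup.toAddSubgroup'.injective
    rw [ha]
    rfl
  conv_rhs => rw [h, index_zpowers_ofAdd]
  exact h

/-- Take any element `(g, d)` of `K` above the generator `d` of its projection; `c` is the class of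
`g`. -/
theorem Subgroup.exists_eq_extendByCoset {G : Type*} [CommGroup G]
    (K : Subgroup (G × Multiplicative ℤ)) : ∃ c : G ⧸ K.comap (MonoidHom.inl G (Multiplicative ℤ)),
      K = (K.comap (MonoidHom.inl G (Multiplicative ℤ))).extendByCoset c (K.map (MonoidHom.snd G _)).index := by
  set d := (K.map (MonoidHom.snd G _)).index with hd
  have hz := Subgroup.eq_zpowers_ofAdd_index (K.map (MonoidHom.snd G _))
  rw [← hd] at hz
  obtain ⟨⟨g, y⟩, hg, hy⟩ : Multiplicative.ofAdd (d : ℤ) ∈ K.map (MonoidHom.snd G _) := by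
    rw [hz]; exact Subgroup.mem_zpowers _
  obtain rfl : y = _ := hy
  refine ⟨(g : G ⧸ _), ?_⟩
  -- Dividing `(h, m * d)` by `(g, d) ^ m`, which lies in `K`, leaves an element of the copy of `G`.
  have key (m : ℤ) (h : G) : ((g : G ⧸ K.comap (MonoidHom.inl G (Multiplicative ℤ))) ^ m = h) ↔
      (h, Multiplicative.ofAdd (m * d)) ∈ K := by
    rw [← QuotientGroup.mk_zpow, QuotientGroup.eq, Subgroup.mem_comap,
      ← Subgroup.mul_mem_cancel_left K (K.zpow_mem hg m)]
    have : (g, Multiplicative.ofAdd (d : ℤ)) ^ m * MonoidHom.inl G _ ((g ^ m)⁻¹ * h) =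
        (h, Multiplicative.ofAdd (m * d)) := by
      rw [MonoidHom.inl_apply, Prod.pow_mk, Prod.mk_mul_mk, ← ofAdd_zsmul, mul_inv_cancel_left,
        mul_one, smul_eq_mul]
    rw [← this]
  ext ⟨h, z⟩
  induction z using Multiplicative.rec with | _ z
  rw [Subgroup.mem_extendByCoset]
  constructor
  · intro hK
    have : Multiplicative.ofAdd z ∈ K.map (MonoidHom.snd G _) := ⟨_, hK, rfl⟩
    obtain ⟨m, hm⟩ := Subgroup.mem_zpowers_iff.1 (hz ▸ this)
    rw [← ofAdd_zsmul, smul_eq_mul] at hm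
    have hm := Multiplicative.ofAdd.injective hm
    exact ⟨m, (key m h).2 (hm ▸ hK), hm⟩
  · rintro ⟨m, h1, rfl⟩
    exact (key m h).1 h1

theorem Subgroup.extendByCoset_injective {G : Type*} [CommGroup G] (K : Subgroup G)
    {d : ℕ} (hd : d ≠ 0) {c c' : G ⧸ K} (h : K.extendByCoset c d = K.extendByCoset c' d) :
    c = c' := by
  obtain ⟨g, rfl⟩ := QuotientGroup.mk_surjective c
  have hg : (g, Multiplicative.ofAdd (d : ℤ)) ∈ K.extendByCoset c' d :=
    h ▸ Subgroup.mem_extendByCoset.2 ⟨1, by simp⟩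
  obtain ⟨m, h1, h2⟩ := Subgroup.mem_extendByCoset.1 hg
  obtain rfl : m = 1 := by
    apply mul_right_cancel₀ (b := (d : ℤ)) (by exact_mod_cast hd)
    simpa using h2
  simpa using h1.symm

/-- A subgroup of `p`-power index in `G × ℤ` is a triple: its trace `K` on `G`, the index `p ^ k` of
its projection, and a coset of `K`. The `[G : K]` choices of coset lower the exponent from `n + 1`
to `n`, and `k` contributes a geometric series. -/
theorem subgroupZeta_prod_int {p : ℕ} (hp : p.Prime) (G : Type*) [CommGroup G] (n : ℕ) :
    subgroupZeta p (G × Multiplicative ℤ) (n + 1) =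
      subgroupZeta p G n * (1 - (p : ℝ≥0∞)⁻¹ ^ (n + 1))⁻¹ := by
  have hpk (k : ℕ) : p ^ k ≠ 0 := pow_ne_zero _ hp.ne_zero
  let f : (Σ x : {K : Subgroup G // ∃ k, K.index = p ^ k} × ℕ, G ⧸ x.1.1) →
      {K : Subgroup (G × Multiplicative ℤ) // ∃ k, K.index = p ^ k} := fun x =>
    ⟨x.1.1.1.extendByCoset x.2 (p ^ x.1.2), by
      obtain ⟨k, hk⟩ := x.1.1.2
      exact ⟨k + x.1.2, by rw [Subgroup.index_extendByCoset _ _ (hpk _), hk, pow_add]⟩⟩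
  have hf : Function.Bijective f := by
    constructor
    · rintro ⟨⟨⟨K, hK⟩, k⟩, c⟩ ⟨⟨⟨K', hK'⟩, k'⟩, c'⟩ h
      have h := Subtype.ext_iff.1 h
      dsimp only [f] at h c c'
      obtain rfl : K = K' := by
        rw [← Subgroup.comap_inl_extendByCoset K c (hpk k), h,
          Subgroup.comap_inl_extendByCoset K' c' (hpk k')]
      obtain rfl : k = k' := by
        apply Nat.pow_right_injective hp.two_le
        dsimp only
        rw [← index_zpowers_ofAdd (p ^ k), ← Subgroup.map_snd_extendByCoset K c, h,
          Subgroup.map_snd_extendByCoset K c', index_zpowers_ofAdd]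
      obtain rfl := Subgroup.extendByCoset_injective K (hpk k) h
      rfl
    · rintro ⟨K, k, hK⟩
      rw [Subgroup.index_prod_eq] at hK
      obtain ⟨i, -, hi⟩ := (Nat.dvd_prime_pow hp).1 (Dvd.intro _ hK)
      obtain ⟨j, -, hj⟩ := (Nat.dvd_prime_pow hp).1 (Dvd.intro_left _ hK)
      obtain ⟨c, hc⟩ := Subgroup.exists_eq_extendByCoset K
      exact ⟨⟨⟨⟨K.comap (MonoidHom.inl G (Multiplicative ℤ)), i, hi⟩, j⟩, c⟩,
        Subtype.ext (by dsimp only [f]; rw [← hj, ← hc])⟩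
  rw [subgroupZeta, ← (Equiv.ofBijective f hf).tsum_eq, ENNReal.tsum_sigma', subgroupZeta,
    ← ENNReal.tsum_geometric, ENNReal.tsum_prod', ← ENNReal.tsum_mul_right]
  refine tsum_congr fun ⟨K, hK⟩ => ?_
  rw [← ENNReal.tsum_mul_left]
  refine tsum_congr fun k => ?_
  have h0 : K.index ≠ 0 := by obtain ⟨i, hi⟩ := hK; rw [hi]; exact hpk i
  have : Finite (G ⧸ K) := Nat.finite_of_card_ne_zero h0
  have hterm (c : G ⧸ K) : (((f ⟨(⟨K, hK⟩, k), c⟩).1.index : ℝ≥0∞)⁻¹) ^ (n + 1) =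
      ((K.index : ℝ≥0∞)⁻¹) ^ (n + 1) * ((p : ℝ≥0∞)⁻¹ ^ (n + 1)) ^ k := by
    dsimp only [f]
    rw [Subgroup.index_extendByCoset _ _ (hpk _), Nat.cast_mul, Nat.cast_pow,
      ENNReal.mul_inv (by simp [h0]) (by simp), mul_pow, ENNReal.inv_pow, ← pow_mul, ← pow_mul,
      mul_comm k]
  simp only [Equiv.ofBijective_apply, hterm]
  rw [ENNReal.tsum_const, ENat.card_eq_coe_natCard, pow_succ, ← Subgroup.index]
  rw [← mul_assoc]
  congr 1
  have h1 : (K.index : ℝ≥0∞) * (K.index : ℝ≥0∞)⁻¹ = 1 :=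
    ENNReal.mul_inv_cancel (by simpa using h0) (by simp)
  rw [mul_left_comm]
  change _ * ((K.index : ℝ≥0∞) * (K.index : ℝ≥0∞)⁻¹) = _
  rw [h1, mul_one]

end SubgroupZeta

/-! ### Sublattices of `ℤⁿ` and the density of surjections onto a finite group. -/

section FreeAbelian

/-- The free abelian group of rank `n`, written multiplicatively. -/
abbrev IntLattice (n : ℕ) : Type := Multiplicative (Fin n → ℤ)

/-- The surjective homomorphisms from `G` to `H`. -/
abbrev SurjHom (G H : Type*) [Group G] [Group H] : Type _ :=
  {f : G →* H // Function.Surjective f}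

/-- Splitting off the first coordinate. -/
def IntLattice.succEquiv (n : ℕ) : IntLattice (n + 1) ≃* IntLattice n × Multiplicative ℤ where
  toFun x := (Multiplicative.ofAdd (Fin.tail x.toAdd), Multiplicative.ofAdd (x.toAdd 0))
  invFun y := Multiplicative.ofAdd (Fin.cons y.2.toAdd y.1.toAdd)
  left_inv x := Fin.cons_self_tail (α := fun _ => ℤ) x.toAdd
  right_inv _ := rfl
  map_mul' _ _ := rfl

theorem subgroupZeta_intLattice {p : ℕ} (hp : p.Prime) (n : ℕ) :
    subgroupZeta p (IntLattice n) n =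
      ∏ i ∈ Finset.range n, (1 - (p : ℝ≥0∞)⁻¹ ^ (i + 1))⁻¹ := by
  induction n with
  | zero =>
    have : Unique {K : Subgroup (IntLattice 0) // ∃ k, K.index = p ^ k} :=
      { default := ⟨⊤, 0, by simp⟩
        uniq := fun K => Subtype.ext (Subsingleton.elim _ _) }
    simp [subgroupZeta, tsum_fintype]
  | succ n ih =>
    rw [subgroupZeta_congr p (IntLattice.succEquiv n), subgroupZeta_prod_int hp, ih,
      Finset.prod_range_succ]

theorem IntLattice.nonempty_mulEquiv_of_index_ne_zero {n : ℕ} (H : Subgroup (IntLattice n))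
    (hH : H.index ≠ 0) : Nonempty (H ≃* IntLattice n) := by
  let A : AddSubgroup (Fin n → ℤ) := Subgroup.toAddSubgroup' H
  have : A.FiniteIndex := ⟨hH⟩
  have hr := AddSubgroup.finrank_eq_of_finiteIndex A
  have hr' : Module.finrank ℤ A.toIntSubmodule = Module.finrank ℤ (Fin n → ℤ) := hr
  obtain ⟨e⟩ := FiniteDimensional.nonempty_linearEquiv_of_finrank_eq hr'
  exact ⟨AddEquiv.toMultiplicative e.toAddEquiv⟩

/-- Homomorphisms from a product are pairs of homomorphisms from the factors. -/
def MonoidHom.coprodEquivProd (G H B : Type*) [Group G] [Group H] [CommGroup B] :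
    (G × H →* B) ≃ (G →* B) × (H →* B) where
  toFun f := (f.comp (MonoidHom.inl G H), f.comp (MonoidHom.inr G H))
  invFun f := f.1.coprod f.2
  left_inv f := f.coprod_unique
  right_inv f := by simp

theorem IntLattice.card_hom (n : ℕ) (B : Type*) [CommGroup B] :
    Nat.card (IntLattice n →* B) = Nat.card B ^ n := by
  induction n with
  | zero =>
    have : Unique (IntLattice 0 →* B) :=
      { default := 1
        uniq := fun f => MonoidHom.ext fun x => by
          rw [Subsingleton.elim x 1, map_one, map_one] }
    simp
  | succ n ih =>
    rw [Nat.card_congr ((IntLattice.succEquiv n).monoidHomCongrLeftEquiv.trans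
      (MonoidHom.coprodEquivProd _ _ B)), Nat.card_prod, ih, pow_succ,
      Nat.card_congr (zpowersHom B).symm]

instance IntLattice.finite_hom (n : ℕ) (B : Type*) [CommGroup B] [Finite B] :
    Finite (IntLattice n →* B) :=
  Nat.finite_of_card_ne_zero (by rw [IntLattice.card_hom]; exact pow_ne_zero _ Nat.card_pos.ne')

/-- A surjection stays surjective whatever the image of one extra generator. -/
theorem IntLattice.card_surjHom_mul_le (n : ℕ) (B : Type*) [CommGroup B] [Finite B] :
    Nat.card (SurjHom (IntLattice n) B) * Nat.card B ≤
      Nat.card (SurjHom (IntLattice (n + 1)) B) := by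
  rw [← Nat.card_prod]
  refine Nat.card_le_card_of_injective (fun x : SurjHom (IntLattice n) B × B =>
    (⟨(x.1.1.coprod (zpowersHom B x.2)).comp (IntLattice.succEquiv n).toMonoidHom, ?_⟩ :
      SurjHom (IntLattice (n + 1)) B)) ?_
  · intro b
    obtain ⟨y, hy⟩ := x.1.2 b
    exact ⟨(IntLattice.succEquiv n).symm (y, 1), by simp [hy]⟩
  · rintro ⟨f, b⟩ ⟨f', b'⟩ h
    have h := Subtype.ext_iff.1 h
    have h2 (y : IntLattice n × Multiplicative ℤ) := DFunLike.congr_fun h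
      ((IntLattice.succEquiv n).symm y)
    refine Prod.ext (Subtype.ext (MonoidHom.ext fun y => ?_)) ?_
    · simpa using h2 (y, 1)
    · simpa using h2 (1, Multiplicative.ofAdd 1)

/-- Union bound: a non-surjective map lands in a proper subgroup, of order at most `|B| / 2`, which
receives at most `(|B| / 2) ^ n` maps. Multiplying by `2 ^ n` keeps the inequality in `ℕ`. -/
theorem IntLattice.card_pow_le (n : ℕ) (B : Type*) [CommGroup B] [Finite B] :
    2 ^ n * Nat.card B ^ n ≤
      2 ^ n * Nat.card (SurjHom (IntLattice n) B) + Nat.card (Subgroup B) * Nat.card B ^ n := by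
  classical
  have := Fintype.ofFinite (Subgroup B)
  have h1 : Nat.card B ^ n ≤ Nat.card (SurjHom (IntLattice n) B) +
      Nat.card (Σ M : {M : Subgroup B // M ≠ ⊤}, IntLattice n →* M.1) := by
    rw [← IntLattice.card_hom, ← Nat.card_sum]
    refine Nat.card_le_card_of_injective (fun f => if hf : Function.Surjective f then
      Sum.inl ⟨f, hf⟩ else Sum.inr ⟨⟨f.range, fun h => hf (MonoidHom.range_eq_top.1 h)⟩,
        f.rangeRestrict⟩) ?_
    have hinv : Function.LeftInverse (Sum.elim (fun f => f.1) fun x => x.1.1.subtype.comp x.2)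
        (fun f : IntLattice n →* B => if hf : Function.Surjective f then
          (Sum.inl ⟨f, hf⟩ : SurjHom (IntLattice n) B ⊕
            Σ M : {M : Subgroup B // M ≠ ⊤}, IntLattice n →* M.1)
          else Sum.inr ⟨⟨f.range, fun h => hf (MonoidHom.range_eq_top.1 h)⟩,
            f.rangeRestrict⟩) := by
      intro f
      by_cases hf : Function.Surjective f
      · simp [hf]
      · simp [hf, MonoidHom.subtype_comp_rangeRestrict]
    exact hinv.injective
  have h2 : 2 ^ n * Nat.card (Σ M : {M : Subgroup B // M ≠ ⊤}, IntLattice n →* M.1) ≤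
      Nat.card (Subgroup B) * Nat.card B ^ n := by
    rw [Nat.card_sigma, Finset.mul_sum]
    calc _ ≤ ∑ M : {M : Subgroup B // M ≠ ⊤}, Nat.card B ^ n := by
          refine Finset.sum_le_sum fun M _ => ?_
          rw [IntLattice.card_hom, ← mul_pow]
          refine Nat.pow_le_pow_left ?_ n
          rw [← M.1.card_mul_index, mul_comm]
          refine Nat.mul_le_mul_left _ ?_
          have h1 : M.1.index ≠ 1 := fun h => M.2 (Subgroup.index_eq_one.1 h)
          have h0 : M.1.index ≠ 0 := Subgroup.index_ne_zero_of_finite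
          omega
      _ ≤ _ := by
          rw [Finset.sum_const, smul_eq_mul, Finset.card_univ, ← Nat.card_eq_fintype_card]
          exact Nat.mul_le_mul_right _ (Finite.card_subtype_le _)
  calc _ ≤ 2 ^ n * (Nat.card (SurjHom (IntLattice n) B) +
      Nat.card (Σ M : {M : Subgroup B // M ≠ ⊤}, IntLattice n →* M.1)) :=
        Nat.mul_le_mul_left _ h1
    _ ≤ _ := by rw [mul_add]; exact Nat.add_le_add_left h2 _

/-- The proportion of the homomorphisms from `ℤⁿ` to `B` that are surjective. -/
noncomputable def surjDensity (B : Type*) [CommGroup B] (n : ℕ) : ℝ≥0∞ :=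
  Nat.card (SurjHom (IntLattice n) B) * ((Nat.card B : ℝ≥0∞)⁻¹) ^ n

theorem card_mul_inv_card (B : Type*) [Finite B] [Nonempty B] :
    (Nat.card B : ℝ≥0∞) * (Nat.card B : ℝ≥0∞)⁻¹ = 1 :=
  ENNReal.mul_inv_cancel (by simpa using Nat.card_pos.ne') (by simp)

theorem monotone_surjDensity (B : Type*) [CommGroup B] [Finite B] :
    Monotone (surjDensity B) := by
  refine monotone_nat_of_le_succ fun n => ?_
  have h : (Nat.card (SurjHom (IntLattice n) B) : ℝ≥0∞) * Nat.card B ≤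
      Nat.card (SurjHom (IntLattice (n + 1)) B) := by
    exact_mod_cast IntLattice.card_surjHom_mul_le n B
  calc surjDensity B n = Nat.card (SurjHom (IntLattice n) B) * ((Nat.card B : ℝ≥0∞)⁻¹) ^ n *
        (Nat.card B * (Nat.card B : ℝ≥0∞)⁻¹) := by
        rw [card_mul_inv_card, mul_one, surjDensity]
    _ = Nat.card (SurjHom (IntLattice n) B) * Nat.card B *
        ((Nat.card B : ℝ≥0∞)⁻¹) ^ (n + 1) := by ring
    _ ≤ _ := mul_le_mul_left h _

theorem tendsto_surjDensity (B : Type*) [CommGroup B] [Finite B] :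
    Filter.Tendsto (surjDensity B) Filter.atTop (nhds 1) := by
  have hmul (n : ℕ) : (Nat.card B : ℝ≥0∞) ^ n * ((Nat.card B : ℝ≥0∞)⁻¹) ^ n = 1 := by
    rw [← mul_pow, card_mul_inv_card, one_pow]
  have hle (n : ℕ) : surjDensity B n ≤ 1 := by
    rw [← hmul n]
    refine mul_le_mul_left ?_ _
    have := Finite.card_subtype_le fun f : IntLattice n →* B => Function.Surjective f
    rw [IntLattice.card_hom] at this
    exact_mod_cast this
  have hge (n : ℕ) : 1 ≤ surjDensity B n + Nat.card (Subgroup B) * (2⁻¹ : ℝ≥0∞) ^ n := by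
    have h : (2 : ℝ≥0∞) ^ n * (Nat.card B : ℝ≥0∞) ^ n ≤
        2 ^ n * Nat.card (SurjHom (IntLattice n) B) +
          Nat.card (Subgroup B) * (Nat.card B : ℝ≥0∞) ^ n := by
      exact_mod_cast IntLattice.card_pow_le n B
    have h2 : (2 : ℝ≥0∞) ^ n * (2⁻¹ : ℝ≥0∞) ^ n = 1 := by
      rw [← mul_pow, ENNReal.mul_inv_cancel (by simp) (by simp), one_pow]
    calc (1 : ℝ≥0∞) = (2 ^ n * 2⁻¹ ^ n) * (Nat.card B ^ n * ((Nat.card B : ℝ≥0∞)⁻¹) ^ n) := by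
          rw [hmul, h2, mul_one]
      _ = 2 ^ n * Nat.card B ^ n * (2⁻¹ ^ n * ((Nat.card B : ℝ≥0∞)⁻¹) ^ n) := by ring
      _ ≤ _ := mul_le_mul_left h _
      _ = (2 ^ n * 2⁻¹ ^ n) * (Nat.card (SurjHom (IntLattice n) B) *
          ((Nat.card B : ℝ≥0∞)⁻¹) ^ n) + (Nat.card B ^ n * ((Nat.card B : ℝ≥0∞)⁻¹) ^ n) *
          (Nat.card (Subgroup B) * 2⁻¹ ^ n) := by ring
      _ = _ := by rw [hmul, h2, one_mul, one_mul, surjDensity]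
  -- Monotonicity provides the limit; only its value remains to be found.
  have hlim := tendsto_atTop_iSup (monotone_surjDensity B)
  have h0 : Filter.Tendsto (fun n => (Nat.card (Subgroup B) : ℝ≥0∞) * (2⁻¹ : ℝ≥0∞) ^ n)
      Filter.atTop (nhds 0) := by
    have := ENNReal.Tendsto.const_mul (a := (Nat.card (Subgroup B) : ℝ≥0∞))
      (ENNReal.tendsto_pow_atTop_nhds_zero_of_lt_one (r := 2⁻¹) (by norm_num))
      (Or.inr (by simp))
    simpa using this
  have h1 : 1 ≤ ⨆ n, surjDensity B n := by
    simpa using ge_of_tendsto' (hlim.add h0) hge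
  rwa [le_antisymm (iSup_le hle) h1] at hlim

end FreeAbelian

/-! ### Surjection counts weighted by automorphisms, at finite level `n`. -/

section SurjectionMoments

theorem tsum_comp_eq_tsum_card_fiber {α β : Type*} (f : α → β) (g : β → ℝ≥0∞)
    [∀ b, Finite {a // f a = b}] :
    ∑' a, g (f a) = ∑' b, (Nat.card {a // f a = b} : ℝ≥0∞) * g b := by
  rw [← (Equiv.sigmaFiberEquiv f).tsum_eq, ENNReal.tsum_sigma']
  refine tsum_congr fun b => ?_
  refine (tsum_congr fun a : {a // f a = b} => congrArg g a.2).trans ?_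
  rw [ENNReal.tsum_const, ENat.card_eq_coe_natCard]
  rfl

/-- The sum over the subgroups of `H` of `p`-power index, normalised by their index in `G`. -/
theorem tsum_subgroup_le_eq (p : ℕ) {G : Type*} [Group G] (H : Subgroup G)
    (hH : ∃ k, H.index = p ^ k) (hp : p.Prime) (n : ℕ) :
    ∑' K : {K : Subgroup G // ∃ k, K.index = p ^ k},
      {K : {K : Subgroup G // ∃ k, K.index = p ^ k} | K.1 ≤ H}.indicator
        (fun K => ((K.1.index : ℝ≥0∞)⁻¹) ^ n) K =
      ((H.index : ℝ≥0∞)⁻¹) ^ n * subgroupZeta p H n := by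
  obtain ⟨j, hj⟩ := hH
  have hidx (K : Subgroup H) : (K.map H.subtype).index = K.index * H.index :=
    Subgroup.index_map_subtype K
  let i : {K : Subgroup H // ∃ k, K.index = p ^ k} →
      {K : Subgroup G // ∃ k, K.index = p ^ k} := fun K => ⟨K.1.map H.subtype, by
    obtain ⟨k, hk⟩ := K.2
    exact ⟨k + j, by rw [hidx, hk, hj, pow_add]⟩⟩
  have hi : Function.Injective i := fun K K' h =>
    Subtype.ext (Subgroup.map_injective H.subtype_injective (Subtype.ext_iff.1 h))
  rw [← hi.tsum_eq, subgroupZeta, ← ENNReal.tsum_mul_left]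
  · refine tsum_congr fun K => ?_
    rw [Set.indicator_of_mem (show (i K).1 ≤ H from Subgroup.map_subtype_le K.1)]
    dsimp only [i]
    rw [hidx, Nat.cast_mul, ENNReal.mul_inv (by simp) (by simp), mul_pow, mul_comm]
  · intro K hK
    have hK : K.1 ≤ H := Set.mem_of_indicator_ne_zero hK
    obtain ⟨k, hk⟩ := K.2
    have hmap : (K.1.subgroupOf H).map H.subtype = K.1 := by
      rw [Subgroup.subgroupOf_map_subtype, inf_eq_left.2 hK]
    have hdvd : (K.1.subgroupOf H).index ∣ p ^ k := by
      rw [← hk]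
      nth_rw 2 [← hmap]
      rw [hidx]
      exact Dvd.intro _ rfl
    obtain ⟨l, -, hl⟩ := (Nat.dvd_prime_pow hp).1 hdvd
    exact ⟨⟨K.1.subgroupOf H, l, hl⟩, Subtype.ext hmap⟩

/-- Surjections from `G ⧸ K` are surjections from `G` whose kernel contains `K`. -/
def SurjHom.quotientEquiv {G A : Type*} [Group G] [Group A] (K : Subgroup G) [K.Normal] :
    SurjHom (G ⧸ K) A ≃ {φ : SurjHom G A // K ≤ φ.1.ker} where
  toFun f := ⟨⟨f.1.comp (QuotientGroup.mk' K), f.2.comp (QuotientGroup.mk'_surjective K)⟩,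
    fun g hg => by
      rw [MonoidHom.mem_ker, MonoidHom.comp_apply, QuotientGroup.mk'_apply,
        (QuotientGroup.eq_one_iff g).2 hg, map_one]⟩
  invFun φ := ⟨QuotientGroup.lift K φ.1.1 φ.2,
    QuotientGroup.lift_surjective_of_surjective K φ.1.1 φ.1.2 φ.2⟩
  left_inv f := Subtype.ext (QuotientGroup.monoidHom_ext _ (by ext; rfl))
  right_inv φ := rfl

theorem SurjHom.index_ker {G A : Type*} [Group G] [Group A] (φ : SurjHom G A) :
    φ.1.ker.index = Nat.card A := by
  rw [Subgroup.index_ker, MonoidHom.range_eq_top.2 φ.2, Subgroup.card_top]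

/-- Exchange the sums: first over `φ : ℤⁿ → A`, then over `K ≤ ker φ`. The kernel has index `|A|`
and is again isomorphic to `ℤⁿ`, so every `φ` contributes the same multiple of the zeta sum of `ℤⁿ`.
-/
theorem tsum_card_surjHom_quotient {p : ℕ} (hp : p.Prime) (n : ℕ) (A : Type*) [CommGroup A]
    [Finite A] (hA : IsPGroup p A) :
    ∑' K : {K : Subgroup (IntLattice n) // ∃ k, K.index = p ^ k},
      (Nat.card (SurjHom (IntLattice n ⧸ K.1) A) : ℝ≥0∞) * ((K.1.index : ℝ≥0∞)⁻¹) ^ n =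
      surjDensity A n * subgroupZeta p (IntLattice n) n := by
  classical
  have := Fact.mk hp
  have hK (K : {K : Subgroup (IntLattice n) // ∃ k, K.index = p ^ k}) :
      (Nat.card (SurjHom (IntLattice n ⧸ K.1) A) : ℝ≥0∞) * ((K.1.index : ℝ≥0∞)⁻¹) ^ n =
      ∑' φ : SurjHom (IntLattice n) A,
        {K : {K : Subgroup (IntLattice n) // ∃ k, K.index = p ^ k} | K.1 ≤ φ.1.ker}.indicator
          (fun K => ((K.1.index : ℝ≥0∞)⁻¹) ^ n) K := by
    rw [Nat.card_congr (SurjHom.quotientEquiv K.1), ← ENat.toENNReal_coe,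
      ← ENat.card_eq_coe_natCard, ← ENNReal.tsum_const]
    exact tsum_subtype {φ : SurjHom (IntLattice n) A | K.1 ≤ φ.1.ker}
      (fun _ => ((K.1.index : ℝ≥0∞)⁻¹) ^ n)
  rw [tsum_congr hK, ENNReal.tsum_comm]
  have hφ (φ : SurjHom (IntLattice n) A) := tsum_subgroup_le_eq p φ.1.ker
    (by rw [φ.index_ker]; exact IsPGroup.iff_card.1 hA) hp n
  have hz (φ : SurjHom (IntLattice n) A) :
      subgroupZeta p φ.1.ker n = subgroupZeta p (IntLattice n) n := by
    obtain ⟨e⟩ := IntLattice.nonempty_mulEquiv_of_index_ne_zero φ.1.ker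
      (by rw [φ.index_ker]; exact Nat.card_pos.ne')
    exact subgroupZeta_congr p e n
  simp_rw [hφ, hz, SurjHom.index_ker]
  rw [ENNReal.tsum_const, ENat.card_eq_coe_natCard, surjDensity, mul_assoc]
  rfl

variable {p : ℕ}

/-- The isomorphism class of the quotient by a subgroup of `p`-power index. -/
def quotientIsoClass (hp : p.Prime) {G : Type} [CommGroup G]
    (K : {K : Subgroup G // ∃ k, K.index = p ^ k}) : FinAbPGroup.IsoClass p :=
  have : Finite (G ⧸ K.1) := Nat.finite_of_card_ne_zero (by
    obtain ⟨k, hk⟩ := K.2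
    exact ne_of_eq_of_ne hk (pow_ne_zero _ hp.ne_zero))
  Quotient.mk (FinAbPGroup.isoSetoid p) ⟨G ⧸ K.1, by
    obtain ⟨k, hk⟩ := K.2
    exact IsPGroup.of_card hk⟩

theorem quotientIsoClass_eq_iff (hp : p.Prime) {G : Type} [CommGroup G]
    (K : {K : Subgroup G // ∃ k, K.index = p ^ k}) (X : FinAbPGroup.IsoClass p) :
    quotientIsoClass hp K = X ↔ Nonempty (G ⧸ K.1 ≃* X.rep.carrier) := by
  conv_lhs => rw [← Quotient.out_eq X]
  exact Quotient.eq

/-- A surjection amounts to its kernel and an identification of the quotient with the target; once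
one identification is chosen for each kernel, the others differ from it by automorphisms. -/
theorem nonempty_surjHom_equiv (hp : p.Prime) {G : Type} [CommGroup G]
    (X : FinAbPGroup.IsoClass p) :
    Nonempty (SurjHom G X.rep.carrier ≃
      {K : {K : Subgroup G // ∃ k, K.index = p ^ k} // quotientIsoClass hp K = X} ×
        MulAut X.rep.carrier) := by
  have := Fact.mk hp
  let e (K : {K : {K : Subgroup G // ∃ k, K.index = p ^ k} // quotientIsoClass hp K = X}) :
      G ⧸ K.1.1 ≃* X.rep.carrier := ((quotientIsoClass_eq_iff hp K.1 X).1 K.2).some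
  let f (x : {K : {K : Subgroup G // ∃ k, K.index = p ^ k} // quotientIsoClass hp K = X} ×
      MulAut X.rep.carrier) : SurjHom G X.rep.carrier :=
    ⟨((e x.1).trans x.2).toMonoidHom.comp (QuotientGroup.mk' x.1.1.1),
      ((e x.1).trans x.2).surjective.comp (QuotientGroup.mk'_surjective _)⟩
  have hker (x) : (f x).1.ker = x.1.1.1 := by
    ext g
    simp [f, MonoidHom.mem_ker]
  refine ⟨(Equiv.ofBijective f ⟨?_, ?_⟩).symm⟩
  · intro x y h
    obtain ⟨K, α⟩ := x
    obtain ⟨K', β⟩ := y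
    obtain rfl : K = K' := Subtype.ext (Subtype.ext (by
      rw [← hker (K, α), h, hker (K', β)]))
    refine Prod.ext rfl (MulEquiv.ext fun b => ?_)
    obtain ⟨g, hg⟩ := ((e K).surjective.comp (QuotientGroup.mk'_surjective _)) b
    have := DFunLike.congr_fun (Subtype.ext_iff.1 h) g
    rw [← hg]
    exact this
  · intro φ
    let E := QuotientGroup.quotientKerEquivOfSurjective φ.1 φ.2
    have hidx : ∃ k, φ.1.ker.index = p ^ k := by
      rw [φ.index_ker]
      exact IsPGroup.iff_card.1 X.rep.isPGroup
    have hX : quotientIsoClass hp ⟨φ.1.ker, hidx⟩ = X :=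
      (quotientIsoClass_eq_iff hp _ X).2 ⟨E⟩
    refine ⟨(⟨⟨φ.1.ker, hidx⟩, hX⟩, (e ⟨⟨φ.1.ker, hidx⟩, hX⟩).symm.trans E),
      Subtype.ext (MonoidHom.ext fun g => ?_)⟩
    simp only [f, MonoidHom.comp_apply, MulEquiv.coe_toMonoidHom, MulEquiv.trans_apply,
      MulEquiv.symm_apply_apply]
    rfl

theorem card_surjHom_eq_mul (hp : p.Prime) {G : Type} [CommGroup G]
    (X : FinAbPGroup.IsoClass p) :
    Nat.card (SurjHom G X.rep.carrier) =
      Nat.card {K : {K : Subgroup G // ∃ k, K.index = p ^ k} // quotientIsoClass hp K = X} *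
        Nat.card (MulAut X.rep.carrier) := by
  obtain ⟨e⟩ := nonempty_surjHom_equiv hp (G := G) X
  rw [Nat.card_congr e, Nat.card_prod]

instance SurjHom.finite {G H : Type*} [Group G] [Group H] [Finite (G →* H)] :
    Finite (SurjHom G H) := Subtype.finite

theorem card_mulAut_ne_zero (A : Type*) [Group A] [Finite A] :
    (Nat.card (MulAut A) : ℝ≥0∞) ≠ 0 := by
  simpa using Nat.card_pos.ne'

theorem card_surjHom_congr {G H A : Type*} [Group G] [Group H] [Group A] (e : G ≃* H) :
    Nat.card (SurjHom G A) = Nat.card (SurjHom H A) := by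
  refine Nat.card_congr (e.monoidHomCongrLeftEquiv.subtypeEquiv fun f => ?_)
  exact (e.symm.surjective.of_comp_iff f).symm

/-- Group the sublattices by their quotient `X`: there are `|Sur(ℤⁿ, X)| / |Aut X|` of them, each of
index `|X|`. -/
theorem tsum_isoClass_surjDensity (hp : p.Prime) (n : ℕ) (A : Type*) [CommGroup A]
    [Finite A] (hA : IsPGroup p A) :
    ∑' X : FinAbPGroup.IsoClass p, (Nat.card (SurjHom X.rep.carrier A) : ℝ≥0∞) *
      (Nat.card (MulAut X.rep.carrier) : ℝ≥0∞)⁻¹ * surjDensity X.rep.carrier n =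
      surjDensity A n * ∏ i ∈ Finset.range n, (1 - (p : ℝ≥0∞)⁻¹ ^ (i + 1))⁻¹ := by
  rw [← subgroupZeta_intLattice hp n, ← tsum_card_surjHom_quotient hp n A hA]
  have hfin (X : FinAbPGroup.IsoClass p) : Finite
      {K : {K : Subgroup (IntLattice n) // ∃ k, K.index = p ^ k} // quotientIsoClass hp K = X} := by
    obtain ⟨e⟩ := nonempty_surjHom_equiv hp (G := IntLattice n) X
    exact Finite.of_injective (fun K => e.symm (K, 1)) fun K K' h =>
      congrArg Prod.fst (e.symm.injective h)
  have hterm (K : {K : Subgroup (IntLattice n) // ∃ k, K.index = p ^ k}) :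
      (Nat.card (SurjHom (IntLattice n ⧸ K.1) A) : ℝ≥0∞) * ((K.1.index : ℝ≥0∞)⁻¹) ^ n =
      (Nat.card (SurjHom (quotientIsoClass hp K).rep.carrier A) : ℝ≥0∞) *
        ((Nat.card (quotientIsoClass hp K).rep.carrier : ℝ≥0∞)⁻¹) ^ n := by
    obtain ⟨e⟩ := (quotientIsoClass_eq_iff hp K _).1 rfl
    rw [card_surjHom_congr e, Subgroup.index, Nat.card_congr e.toEquiv]
  rw [tsum_congr hterm, tsum_comp_eq_tsum_card_fiber (quotientIsoClass hp) (fun X =>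
    (Nat.card (SurjHom X.rep.carrier A) : ℝ≥0∞) * ((Nat.card X.rep.carrier : ℝ≥0∞)⁻¹) ^ n)]
  refine tsum_congr fun X => ?_
  have h1 := ENNReal.mul_inv_cancel (card_mulAut_ne_zero X.rep.carrier)
    (ENNReal.natCast_ne_top _)
  rw [surjDensity, card_surjHom_eq_mul hp X (G := IntLattice n), Nat.cast_mul]
  calc _ = (Nat.card (MulAut X.rep.carrier) : ℝ≥0∞) *
        (Nat.card (MulAut X.rep.carrier) : ℝ≥0∞)⁻¹ * (Nat.card {K : {K : Subgroup (IntLattice n) //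
          ∃ k, K.index = p ^ k} // quotientIsoClass hp K = X} *
        (Nat.card (SurjHom X.rep.carrier A) * ((Nat.card X.rep.carrier : ℝ≥0∞)⁻¹) ^ n)) := by ring
    _ = _ := by rw [h1, one_mul]

end SurjectionMoments

/-! ### The constant `c` and the passage to the limit in `n`. -/

section CohenLenstraConstant

/-- The constant `∏_{i ≥ 1} (1 - p⁻ⁱ)`. -/
noncomputable def cohenLenstraConst (p : ℕ) : ℝ := ∏' i : ℕ, (1 - ((p : ℝ) ^ (i + 1))⁻¹)

theorem tendsto_prod_cohenLenstraConst {p : ℕ} (hp : 2 ≤ p) :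
    Filter.Tendsto (fun n => ∏ i ∈ Finset.range n, (1 - ((p : ℝ) ^ (i + 1))⁻¹)) Filter.atTop
      (nhds (cohenLenstraConst p)) := by
  have hp' : (1 : ℝ) < p := by exact_mod_cast hp
  have hs : Summable fun i : ℕ => -((p : ℝ) ^ (i + 1))⁻¹ := by
    refine Summable.neg ?_
    simp_rw [← inv_pow]
    exact (summable_nat_add_iff 1).2
      (summable_geometric_of_lt_one (by positivity) (inv_lt_one_of_one_lt₀ hp'))
  have := (Real.multipliable_one_add_of_summable hs).hasProd.tendsto_prod_nat
  simpa only [← sub_eq_add_neg, cohenLenstraConst] using this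

/-- The slack `3⁻ⁿ / 9` makes the induction close: the next factor removes at most `(2/3) * 3⁻ⁿ /
9`, leaving exactly `3⁻ⁿ / 27`. -/
theorem prod_one_sub_inv_three_pow_ge (n : ℕ) :
    5 / 9 + 1 / 9 * ((3 : ℝ) ^ n)⁻¹ ≤ ∏ i ∈ Finset.range (n + 1), (1 - ((3 : ℝ) ^ (i + 1))⁻¹) ∧
      ∏ i ∈ Finset.range (n + 1), (1 - ((3 : ℝ) ^ (i + 1))⁻¹) ≤ 2 / 3 := by
  induction n with
  | zero => norm_num
  | succ n ih =>
    obtain ⟨h1, h2⟩ := ih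
    rw [Finset.prod_range_succ]
    set P := ∏ i ∈ Finset.range (n + 1), (1 - ((3 : ℝ) ^ (i + 1))⁻¹)
    have h3 : 0 < ((3 : ℝ) ^ n)⁻¹ := by positivity
    have e1 : ((3 : ℝ) ^ (n + 1))⁻¹ = ((3 : ℝ) ^ n)⁻¹ / 3 := by rw [pow_succ]; field_simp
    have e2 : ((3 : ℝ) ^ (n + 1 + 1))⁻¹ = ((3 : ℝ) ^ n)⁻¹ / 9 := by
      rw [pow_succ, pow_succ]; field_simp; norm_num
    rw [e1, e2]
    constructor <;> nlinarith

theorem five_ninths_le_cohenLenstraConst {p : ℕ} (hp : 3 ≤ p) : 5 / 9 ≤ cohenLenstraConst p := by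
  have hp' : (3 : ℝ) ≤ p := by exact_mod_cast hp
  refine ge_of_tendsto ((tendsto_prod_cohenLenstraConst (by omega)).comp
    (Filter.tendsto_add_atTop_nat 1)) (Filter.Eventually.of_forall fun n => ?_)
  calc (5 : ℝ) / 9 ≤ 5 / 9 + 1 / 9 * ((3 : ℝ) ^ n)⁻¹ := by
        have : 0 < ((3 : ℝ) ^ n)⁻¹ := by positivity
        linarith
    _ ≤ _ := (prod_one_sub_inv_three_pow_ge n).1
    _ ≤ _ := by
        refine Finset.prod_le_prod (fun i _ => ?_) fun i _ => ?_
        · rw [sub_nonneg]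
          exact inv_le_one_of_one_le₀ (one_le_pow₀ (by norm_num))
        · gcongr

theorem cohenLenstraConst_le_one {p : ℕ} (hp : 2 ≤ p) : cohenLenstraConst p ≤ 1 := by
  have hp' : (1 : ℝ) ≤ p := by exact_mod_cast (by omega : 1 ≤ p)
  refine le_of_tendsto' (tendsto_prod_cohenLenstraConst hp) fun n => ?_
  refine Finset.prod_le_one (fun i _ => ?_) fun i _ => ?_
  · rw [sub_nonneg]
    exact inv_le_one_of_one_le₀ (one_le_pow₀ hp')
  · rw [sub_le_self_iff]
    positivity

theorem tendsto_prod_inv_cohenLenstraConst {p : ℕ} (hp : 2 ≤ p) :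
    Filter.Tendsto (fun n => ∏ i ∈ Finset.range n, (1 - (p : ℝ≥0∞)⁻¹ ^ (i + 1))⁻¹) Filter.atTop
      (nhds (ENNReal.ofReal (cohenLenstraConst p))⁻¹) := by
  have hp' : (1 : ℝ) < p := by exact_mod_cast hp
  have h := tendsto_inv_iff.2
    ((ENNReal.continuous_ofReal.tendsto _).comp (tendsto_prod_cohenLenstraConst hp))
  refine h.congr fun n => ?_
  have hnonneg (i : ℕ) : 0 < 1 - ((p : ℝ) ^ (i + 1))⁻¹ := by
    rw [sub_pos]
    exact inv_lt_one_of_one_lt₀ (one_lt_pow₀ hp' (by omega))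
  have hterm (i : ℕ) : (1 - (p : ℝ≥0∞)⁻¹ ^ (i + 1))⁻¹ =
      ENNReal.ofReal (1 - ((p : ℝ) ^ (i + 1))⁻¹)⁻¹ := by
    rw [ENNReal.ofReal_inv_of_pos (hnonneg i), ENNReal.ofReal_sub _ (by positivity),
      ENNReal.ofReal_inv_of_pos (by positivity), ENNReal.ofReal_pow (by positivity),
      ENNReal.ofReal_natCast, ENNReal.ofReal_one, ENNReal.inv_pow]
  simp_rw [hterm, Function.comp_apply]
  rw [← ENNReal.ofReal_prod_of_nonneg fun i _ => (inv_pos.2 (hnonneg i)).le,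
    ← ENNReal.ofReal_inv_of_pos (Finset.prod_pos fun i _ => hnonneg i), Finset.prod_inv_distrib]

theorem tsum_card_surjHom_div_card_mulAut {p : ℕ} (hp : p.Prime) (A : Type*)
    [CommGroup A] [Finite A] (hA : IsPGroup p A) :
    ∑' X : FinAbPGroup.IsoClass p, (Nat.card (SurjHom X.rep.carrier A) : ℝ≥0∞) *
      (Nat.card (MulAut X.rep.carrier) : ℝ≥0∞)⁻¹ =
      (ENNReal.ofReal (cohenLenstraConst p))⁻¹ := by
  have hR := ENNReal.Tendsto.mul (tendsto_surjDensity A) (Or.inl one_ne_zero)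
    (tendsto_prod_inv_cohenLenstraConst hp.two_le) (Or.inr ENNReal.one_ne_top)
  rw [one_mul] at hR
  refine tendsto_nhds_unique ?_ hR
  simp_rw [← tsum_isoClass_surjDensity hp _ A hA]
  -- As integrals for the counting measure, the sums fall under monotone convergence, since
  -- `surjDensity` increases to `1`.
  simp_rw [← lintegral_count' measurable_from_top]
  refine lintegral_tendsto_of_tendsto_of_monotone (fun n => measurable_from_top.aemeasurable)
    (Filter.Eventually.of_forall fun X n m h => ?_) (Filter.Eventually.of_forall fun X => ?_)
  · exact mul_le_mul_right (monotone_surjDensity _ h) _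
  · have := ENNReal.Tendsto.const_mul (a := (Nat.card (SurjHom X.rep.carrier A) : ℝ≥0∞) *
      (Nat.card (MulAut X.rep.carrier) : ℝ≥0∞)⁻¹) (tendsto_surjDensity X.rep.carrier)
      (Or.inl one_ne_zero)
    rwa [mul_one] at this

end CohenLenstraConstant

/-! ### Pointed groups: orbit counting, row sums and the values of the measure. -/

section PointedGroups

variable {p : ℕ}

/-- The isomorphism class of the group obtained by forgetting the point. -/
def PointedFinAbPGroup.groupClass (A : PointedFinAbPGroup p) : FinAbPGroup.IsoClass p :=
  Quotient.mk (FinAbPGroup.isoSetoid p) A.toFinAbPGroup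

theorem PointedFinAbPGroup.nonempty_groupClass_rep_equiv (A : PointedFinAbPGroup p) :
    Nonempty (A.groupClass.rep.carrier ≃* A.carrier) :=
  Quotient.mk_out (s := FinAbPGroup.isoSetoid p) A.toFinAbPGroup

theorem PointedFinAbPGroup.isoClass_eq_iff (A : PointedFinAbPGroup p)
    (Y : PointedFinAbPGroup.IsoClass p) :
    A.isoClass = Y ↔ ∃ e : A.carrier ≃* Y.rep.carrier, e A.point = Y.rep.point := by
  conv_lhs => rw [← Quotient.out_eq Y]
  exact Quotient.eq

/-- The class of `(B, b)`, where `B` is the representative of an isomorphism class of groups. -/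
noncomputable def pointedClass (x : Σ X : FinAbPGroup.IsoClass p, X.rep.carrier) :
    PointedFinAbPGroup.IsoClass p :=
  PointedFinAbPGroup.isoClass (PointedFinAbPGroup.mk x.1.rep x.2)

/-- Two points of one group give isomorphic pointed groups exactly when an automorphism relates
them. -/
theorem PointedFinAbPGroup.nonempty_fiber_equiv_orbit (Y : PointedFinAbPGroup.IsoClass p) :
    Nonempty (MulAction.orbit (MulAut Y.rep.carrier) Y.rep.point ≃
      {x : Σ X : FinAbPGroup.IsoClass p, X.rep.carrier // pointedClass x = Y}) := by
  obtain ⟨e⟩ := Y.rep.nonempty_groupClass_rep_equiv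
  let f (a : MulAction.orbit (MulAut Y.rep.carrier) Y.rep.point) :
      {x : Σ X : FinAbPGroup.IsoClass p, X.rep.carrier // pointedClass x = Y} :=
    ⟨⟨Y.rep.groupClass, e.symm a.1⟩, by
      obtain ⟨_, α, rfl⟩ := a
      refine (isoClass_eq_iff _ _).2 ⟨e.trans α.symm, ?_⟩
      change α.symm (e (e.symm (α Y.rep.point))) = _
      rw [e.apply_symm_apply, α.symm_apply_apply]⟩
  refine ⟨Equiv.ofBijective f ⟨fun a b h => ?_, ?_⟩⟩
  · have h := eq_of_heq (Sigma.mk.inj (Subtype.ext_iff.1 h)).2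
    exact Subtype.ext (e.symm.injective h)
  · rintro ⟨⟨X, b⟩, h⟩
    obtain ⟨e', he'⟩ := (isoClass_eq_iff _ _).1 h
    obtain rfl : Y.rep.groupClass = X := by
      conv_rhs => rw [← Quotient.out_eq X]
      exact Quotient.sound ⟨e'.symm⟩
    refine ⟨⟨e b, e'.symm.trans e, ?_⟩, ?_⟩
    · change e (e'.symm Y.rep.point) = e b
      rw [← he', e'.symm_apply_apply]
    · refine Subtype.ext ?_
      dsimp only [f]
      rw [e.symm_apply_apply]

instance MonoidHom.finite_of_finite {G H : Type*} [Group G] [Group H] [Finite G] [Finite H] :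
    Finite (G →* H) :=
  Finite.of_injective _ DFunLike.coe_injective

instance PointedFinAbPGroup.finite_sur (A B : PointedFinAbPGroup p) : Finite (A.Sur B) :=
  Subtype.finite

/-- Surjective endomorphisms of a pointed finite group are its automorphisms. -/
theorem PointedFinAbPGroup.card_stabilizer (A : PointedFinAbPGroup p) :
    Nat.card (MulAction.stabilizer (MulAut A.carrier) A.point) = Nat.card (A.Sur A) := by
  let f (α : MulAction.stabilizer (MulAut A.carrier) A.point) : A.Sur A :=
    ⟨α.1.toMonoidHom, α.1.surjective, α.2⟩
  refine Nat.card_congr (Equiv.ofBijective f ⟨fun α β h => ?_, fun φ => ?_⟩)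
  · have h := congrArg Subtype.val h
    exact Subtype.ext (MulEquiv.ext fun x => DFunLike.congr_fun h x)
  · exact ⟨⟨MulEquiv.ofBijective φ.1 ⟨Finite.injective_iff_surjective.2 φ.2.1, φ.2.1⟩, φ.2.2⟩,
      rfl⟩

instance PointedFinAbPGroup.finite_fiber (Y : PointedFinAbPGroup.IsoClass p) :
    Finite {x : Σ X : FinAbPGroup.IsoClass p, X.rep.carrier // pointedClass x = Y} := by
  obtain ⟨e⟩ := PointedFinAbPGroup.nonempty_fiber_equiv_orbit Y
  exact Finite.of_equiv _ e

theorem PointedFinAbPGroup.card_fiber_mul_card_sur (Y : PointedFinAbPGroup.IsoClass p) :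
    Nat.card {x : Σ X : FinAbPGroup.IsoClass p, X.rep.carrier // pointedClass x = Y} *
      Nat.card (Y.rep.Sur Y.rep) = Nat.card (MulAut Y.rep.carrier) := by
  obtain ⟨e⟩ := PointedFinAbPGroup.nonempty_fiber_equiv_orbit Y
  rw [← Nat.card_congr e, ← PointedFinAbPGroup.card_stabilizer, ← Nat.card_prod,
    Nat.card_congr (MulAction.orbitProdStabilizerEquivGroup _ _)]

instance PointedFinAbPGroup.nonempty_sur_self (A : PointedFinAbPGroup p) : Nonempty (A.Sur A) :=
  ⟨⟨MonoidHom.id _, Function.surjective_id, rfl⟩⟩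

theorem card_mulAut_congr {G H : Type*} [Group G] [Group H] (e : G ≃* H) :
    Nat.card (MulAut G) = Nat.card (MulAut H) :=
  Nat.card_congr (MulAut.congr e).toEquiv

theorem exists_pointedClass_rep_equiv (x : Σ X : FinAbPGroup.IsoClass p, X.rep.carrier) :
    ∃ e : x.1.rep.carrier ≃* (pointedClass x).rep.carrier, e x.2 = (pointedClass x).rep.point :=
  (PointedFinAbPGroup.isoClass_eq_iff (PointedFinAbPGroup.mk x.1.rep x.2) _).1 rfl

/-- Summing over pointed groups with weight `1 / |Aut (B, b)|` is summing over groups with weight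
`1 / |Aut B|` and over their elements. -/
theorem tsum_pointed_eq (F : PointedFinAbPGroup.IsoClass p → ℝ≥0∞) :
    ∑' Y : PointedFinAbPGroup.IsoClass p, F Y * (Nat.card (Y.rep.Sur Y.rep) : ℝ≥0∞)⁻¹ =
      ∑' X : FinAbPGroup.IsoClass p, (∑' b : X.rep.carrier, F (pointedClass ⟨X, b⟩)) *
        (Nat.card (MulAut X.rep.carrier) : ℝ≥0∞)⁻¹ := by
  simp_rw [← ENNReal.tsum_mul_right]
  have hX (X : FinAbPGroup.IsoClass p) (b : X.rep.carrier) :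
      F (pointedClass ⟨X, b⟩) * (Nat.card (MulAut X.rep.carrier) : ℝ≥0∞)⁻¹ =
      F (pointedClass ⟨X, b⟩) *
        (Nat.card (MulAut (pointedClass ⟨X, b⟩).rep.carrier) : ℝ≥0∞)⁻¹ := by
    obtain ⟨e, -⟩ := exists_pointedClass_rep_equiv ⟨X, b⟩
    rw [card_mulAut_congr e]
  simp_rw [hX]
  rw [← ENNReal.tsum_sigma' (fun x : Σ X : FinAbPGroup.IsoClass p, X.rep.carrier =>
    F (pointedClass x) * (Nat.card (MulAut (pointedClass x).rep.carrier) : ℝ≥0∞)⁻¹),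
    tsum_comp_eq_tsum_card_fiber pointedClass
      (fun Y => F Y * (Nat.card (MulAut Y.rep.carrier) : ℝ≥0∞)⁻¹)]
  refine tsum_congr fun Y => ?_
  -- Orbit–stabilizer: the fibre over `Y` is an orbit of `Aut`, and `Sur(Y, Y)` has the size of the
  -- stabilizer.
  have hY := PointedFinAbPGroup.card_fiber_mul_card_sur Y
  set k := Nat.card {x : Σ X : FinAbPGroup.IsoClass p, X.rep.carrier // pointedClass x = Y}
  have hk : k ≠ 0 := fun h => by
    rw [h, zero_mul] at hY
    exact Nat.card_pos.ne hY
  rw [← hY, Nat.cast_mul, ENNReal.mul_inv (by simp) (by simp), mul_left_comm,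
    ← mul_assoc (k : ℝ≥0∞), ENNReal.mul_inv_cancel (by simpa using hk) (by simp), one_mul]

theorem PointedFinAbPGroup.card_sur_congr {A B C : PointedFinAbPGroup p}
    (e : A.carrier ≃* B.carrier) (he : e A.point = B.point) :
    Nat.card (A.Sur C) = Nat.card (B.Sur C) := by
  refine Nat.card_congr (e.monoidHomCongrLeftEquiv.subtypeEquiv fun f => ?_)
  rw [← he]
  refine and_congr (e.symm.surjective.of_comp_iff f).symm ?_
  change _ ↔ f (e.symm (e A.point)) = _
  rw [e.symm_apply_apply]

/-- Double count pairs `(b, φ)` with `φ b = a`: every fibre of a surjection `φ` has `|B| / |A|`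
elements. -/
theorem tsum_card_sur (B : FinAbPGroup p) (A : PointedFinAbPGroup p) :
    ∑' b : B.carrier, (Nat.card ((PointedFinAbPGroup.mk B b).Sur A) : ℝ≥0∞) =
      Nat.card (SurjHom B.carrier A.carrier) *
        (Nat.card B.carrier * (Nat.card A.carrier : ℝ≥0∞)⁻¹) := by
  have hfib (φ : SurjHom B.carrier A.carrier) :
      (Nat.card {b // φ.1 b = A.point} : ℝ≥0∞) =
        Nat.card B.carrier * (Nat.card A.carrier : ℝ≥0∞)⁻¹ := by
    rw [← ENNReal.div_eq_inv_mul.trans (mul_comm _ _), ENNReal.eq_div_iff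
      (by simpa using Nat.card_pos.ne') (by simp)]
    rw [show Nat.card {b // φ.1 b = A.point} = Nat.card φ.1.ker from
      Nat.card_congr (MonoidHom.fiberEquivKerOfSurjective φ.2 A.point)]
    rw [← φ.index_ker, ← φ.1.ker.card_mul_index, Nat.cast_mul, mul_comm]
  let E : (Σ b : B.carrier, (PointedFinAbPGroup.mk B b).Sur A) ≃
      Σ φ : SurjHom B.carrier A.carrier, {b // φ.1 b = A.point} :=
    { toFun := fun x => ⟨⟨x.2.1, x.2.2.1⟩, ⟨x.1, x.2.2.2⟩⟩
      invFun := fun y => ⟨y.2.1, ⟨y.1.1, y.1.2, y.2.2⟩⟩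
      left_inv := fun _ => rfl
      right_inv := fun _ => rfl }
  have hE := E.tsum_eq (fun _ => (1 : ℝ≥0∞))
  rw [ENNReal.tsum_sigma', ENNReal.tsum_sigma'] at hE
  simp only [ENNReal.tsum_const, ENat.card_eq_coe_natCard, mul_one, ENat.toENNReal_coe] at hE
  rw [hE, tsum_congr hfib, ENNReal.tsum_const, ENat.card_eq_coe_natCard, ENat.toENNReal_coe]

theorem tsum_card_sur_div (hp : p.Prime) (A : PointedFinAbPGroup p) :
    ∑' Y : PointedFinAbPGroup.IsoClass p, (Nat.card (Y.rep.Sur A) : ℝ≥0∞) *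
      ((Nat.card Y.rep.carrier : ℝ≥0∞)⁻¹ * (Nat.card (Y.rep.Sur Y.rep) : ℝ≥0∞)⁻¹) =
      (Nat.card A.carrier : ℝ≥0∞)⁻¹ * (ENNReal.ofReal (cohenLenstraConst p))⁻¹ := by
  simp_rw [← mul_assoc]
  rw [tsum_pointed_eq, ← tsum_card_surjHom_div_card_mulAut hp A.carrier A.isPGroup,
    ← ENNReal.tsum_mul_left]
  refine tsum_congr fun X => ?_
  have hb (b : X.rep.carrier) : (Nat.card ((pointedClass ⟨X, b⟩).rep.Sur A) : ℝ≥0∞) *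
      (Nat.card (pointedClass ⟨X, b⟩).rep.carrier : ℝ≥0∞)⁻¹ =
      Nat.card ((PointedFinAbPGroup.mk X.rep b).Sur A) * (Nat.card X.rep.carrier : ℝ≥0∞)⁻¹ := by
    obtain ⟨e, he⟩ := exists_pointedClass_rep_equiv ⟨X, b⟩
    rw [PointedFinAbPGroup.card_sur_congr (A := PointedFinAbPGroup.mk X.rep b) e he,
      Nat.card_congr e.toEquiv]
  rw [tsum_congr hb, ENNReal.tsum_mul_right, tsum_card_sur]
  calc _ = (Nat.card X.rep.carrier * (Nat.card X.rep.carrier : ℝ≥0∞)⁻¹) *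
        ((Nat.card A.carrier : ℝ≥0∞)⁻¹ * (Nat.card (SurjHom X.rep.carrier A.carrier) *
        (Nat.card (MulAut X.rep.carrier) : ℝ≥0∞)⁻¹)) := by ring
    _ = _ := by rw [card_mul_inv_card, one_mul]

theorem uniformPointing_singleton (X : FinAbPGroup.IsoClass p)
    (Y : PointedFinAbPGroup.IsoClass p) :
    uniformPointing X.rep {Y} =
      ∑' b : X.rep.carrier, ({Y} : Set (PointedFinAbPGroup.IsoClass p)).indicator
        (fun Z => (Nat.card Z.rep.carrier : ℝ≥0∞)⁻¹) (pointedClass ⟨X, b⟩) := by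
  classical
  let : Fintype X.rep.carrier := Fintype.ofFinite _
  rw [uniformPointing, PMF.toMeasure_apply_singleton _ _ MeasurableSpace.measurableSet_top, PMF.map_apply]
  refine tsum_congr fun b => ?_
  rw [Set.indicator_apply]
  have hcard : Nat.card X.rep.carrier = Nat.card (pointedClass ⟨X, b⟩).rep.carrier := by
    obtain ⟨e, -⟩ := exists_pointedClass_rep_equiv ⟨X, b⟩
    exact Nat.card_congr e.toEquiv
  rw [PMF.uniformOfFintype_apply, ← hcard, Nat.card_eq_fintype_card]
  exact if_congr eq_comm rfl rfl

theorem pointedCohenLenstraMeasure_singleton (Y : PointedFinAbPGroup.IsoClass p) :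
    pointedCohenLenstraMeasure p {Y} = ENNReal.ofReal (cohenLenstraConst p) *
      ((Nat.card Y.rep.carrier : ℝ≥0∞)⁻¹ * (Nat.card (Y.rep.Sur Y.rep) : ℝ≥0∞)⁻¹) := by
  classical
  have hw (X : FinAbPGroup.IsoClass p) : ENNReal.ofReal (cohenLenstraWeight p X.rep) =
      ENNReal.ofReal (cohenLenstraConst p) * (Nat.card (MulAut X.rep.carrier) : ℝ≥0∞)⁻¹ := by
    have hpos : (0 : ℝ) < Nat.card (MulAut X.rep.carrier) := by exact_mod_cast Nat.card_pos
    rw [cohenLenstraWeight, ENNReal.ofReal_mul (by positivity), ENNReal.ofReal_inv_of_pos hpos,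
      ENNReal.ofReal_natCast, mul_comm]
    rfl
  rw [pointedCohenLenstraMeasure, Measure.bind_apply MeasurableSpace.measurableSet_top measurable_from_top.aemeasurable,
    cohenLenstraMeasure, lintegral_sum_measure]
  simp_rw [lintegral_smul_measure, lintegral_dirac' _ measurable_from_top, smul_eq_mul, hw,
    uniformPointing_singleton, mul_assoc, ENNReal.tsum_mul_left]
  congr 1
  have h := tsum_pointed_eq (({Y} : Set (PointedFinAbPGroup.IsoClass p)).indicator
    (fun Z => (Nat.card Z.rep.carrier : ℝ≥0∞)⁻¹))
  rw [tsum_congr fun X => mul_comm _ _, ← h, tsum_eq_single Y]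
  · rw [Set.indicator_of_mem (Set.mem_singleton Y)]
  · intro Z hZ
    rw [Set.indicator_of_notMem (by simpa using hZ), zero_mul]

/-- A class is determined by a multiplication table on some `Fin n` and a marked index. Countability
lets a measure be determined by its values on singletons. -/
instance PointedFinAbPGroup.countable_isoClass : Countable (PointedFinAbPGroup.IsoClass p) := by
  have h (Y : PointedFinAbPGroup.IsoClass p) : ∃ x : Σ n : ℕ, (Fin n → Fin n → Fin n) × Fin n,
      ∃ e : Y.rep.carrier ≃ Fin x.1, (∀ a b, e (a * b) = x.2.1 (e a) (e b)) ∧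
        e Y.rep.point = x.2.2 := by
    let e := Finite.equivFin Y.rep.carrier
    exact ⟨⟨_, fun i j => e (e.symm i * e.symm j), e Y.rep.point⟩, e, by simp, rfl⟩
  choose f hf using h
  refine Function.Injective.countable (f := f) fun Y Z h => ?_
  have hY := hf Y
  rw [h] at hY
  obtain ⟨e, hm, he⟩ := hY
  obtain ⟨e', hm', he'⟩ := hf Z
  rw [← Quotient.out_eq Y]
  refine (PointedFinAbPGroup.isoClass_eq_iff _ _).2
    ⟨MulEquiv.mk (e.trans e'.symm) fun a b => ?_, ?_⟩
  · change e'.symm (e (a * b)) = e'.symm (e a) * e'.symm (e b)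
    rw [Equiv.symm_apply_eq, hm', e'.apply_symm_apply, e'.apply_symm_apply]
    exact hm a b
  · change e'.symm (e Y.rep.point) = _
    rw [he, ← he', e'.symm_apply_apply]

end PointedGroups

/-! ### Uniqueness for diagonally dominant systems, and the conclusion. -/

/-- One contraction step. Comparing the equations of `v` and `w` at `x`, an excess of `v` on the
diagonal is offset by an excess of `w` off it, which is at most `t` times the off-diagonal sum of
`u`, that is `t * r * m x`. -/
theorem le_add_mul_of_tsum_eq {ι : Type*} {s : ι → ι → ℝ≥0∞} {u v w m : ι → ℝ≥0∞} {r t : ℝ≥0∞}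
    (hv : ∀ x, ∑' y, s y x * v y = m x) (hw : ∀ x, ∑' y, s y x * w y = m x)
    (hu : ∀ x, ∑' y, s y x * u y = m x * (1 + r)) (hdiag : ∀ x, s x x * u x = m x)
    (hm : ∀ x, m x ≠ ⊤) (hs0 : ∀ x, s x x ≠ 0) (hs : ∀ x, s x x ≠ ⊤)
    (h : ∀ x, w x ≤ v x + t * u x) (x : ι) : v x ≤ w x + t * r * u x := by
  classical
  let R (z : ι → ℝ≥0∞) : ℝ≥0∞ := ∑' y, if y = x then 0 else s y x * z y
  have hsplit (z : ι → ℝ≥0∞) : ∑' y, s y x * z y = s x x * z x + R z :=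
    ENNReal.tsum_eq_add_tsum_ite x
  have hRu : R u = m x * r := by
    have := hu x
    rw [hsplit, hdiag, mul_add, mul_one] at this
    exact (ENNReal.add_right_inj (hm x)).1 this
  have hRw : R w ≤ R v + t * (m x * r) := by
    rw [← hRu, ← ENNReal.tsum_mul_left, ← ENNReal.tsum_add]
    refine ENNReal.tsum_le_tsum fun y => ?_
    split_ifs with hy
    · simp
    · calc s y x * w y ≤ s y x * (v y + t * u y) := mul_le_mul_right (h y) _
        _ = _ := by ring
  -- Finiteness is what allows `R v` to be cancelled in `ℝ≥0∞`.
  have hRv : R v ≠ ⊤ := fun htop => hm x (by rw [← hv x, hsplit, htop, add_top])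
  have hle : s x x * v x ≤ s x x * (w x + t * r * u x) := by
    refine (ENNReal.add_le_add_iff_right hRv).1 ?_
    calc s x x * v x + R v = s x x * w x + R w := by rw [← hsplit, ← hsplit, hv, hw]
      _ ≤ s x x * w x + (R v + t * (m x * r)) := by gcongr
      _ = _ := by rw [← hdiag]; ring
  exact (ENNReal.mul_le_mul_iff_right (hs0 x) (hs x)).1 hle

/-- A system of linear equations that is diagonally dominant relative to the weights `u` has at
most one nonnegative solution. -/
theorem eq_of_tsum_eq_of_diag_dominant {ι : Type*} {s : ι → ι → ℝ≥0∞} {u v w m : ι → ℝ≥0∞}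
    {r : ℝ≥0∞} (hv : ∀ x, ∑' y, s y x * v y = m x) (hw : ∀ x, ∑' y, s y x * w y = m x)
    (hu : ∀ x, ∑' y, s y x * u y = m x * (1 + r)) (hdiag : ∀ x, s x x * u x = m x)
    (hm : ∀ x, m x ≠ ⊤) (hs0 : ∀ x, s x x ≠ 0) (hs : ∀ x, s x x ≠ ⊤) (hr : r < 1) : v = w := by
  -- A priori bound that starts the iteration: the diagonal term alone is at most the whole sum `m
  -- x`.
  have hle_u {z : ι → ℝ≥0∞} (hz : ∀ x, ∑' y, s y x * z y = m x) (x : ι) : z x ≤ u x := by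
    refine (ENNReal.mul_le_mul_iff_right (hs0 x) (hs x)).1 ?_
    rw [hdiag, ← hz x]
    exact ENNReal.le_tsum (f := fun y => s y x * z y) x
  have hiter (n : ℕ) : (∀ x, v x ≤ w x + r ^ n * u x) ∧ ∀ x, w x ≤ v x + r ^ n * u x := by
    induction n with
    | zero => exact ⟨fun x => by simpa using (hle_u hv x).trans le_add_self,
        fun x => by simpa using (hle_u hw x).trans le_add_self⟩
    | succ n ih =>
      rw [pow_succ]
      exact ⟨le_add_mul_of_tsum_eq hv hw hu hdiag hm hs0 hs ih.2,
        le_add_mul_of_tsum_eq hw hv hu hdiag hm hs0 hs ih.1⟩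
  have hux (x : ι) : u x ≠ ⊤ := fun h => hm x (by rw [← hdiag, h, ENNReal.mul_top (hs0 x)])
  have hlim (z : ι → ℝ≥0∞) (x : ι) :
      Filter.Tendsto (fun n => z x + r ^ n * u x) Filter.atTop (nhds (z x)) := by
    have := (ENNReal.Tendsto.mul_const (ENNReal.tendsto_pow_atTop_nhds_zero_of_lt_one hr)
      (Or.inr (hux x))).const_add (z x)
    rwa [zero_mul, add_zero] at this
  exact funext fun x => le_antisymm (ge_of_tendsto' (hlim w x) fun n => (hiter n).1 x)
    (ge_of_tendsto' (hlim v x) fun n => (hiter n).2 x)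

/-- Here `r = 1 / c - 1`, and `c ≥ 5/9` gives `r ≤ 4/5`. -/
theorem inv_cohenLenstraConst_eq_one_add {p : ℕ} (hp : 3 ≤ p) :
    ∃ r < 1, (ENNReal.ofReal (cohenLenstraConst p))⁻¹ = 1 + r := by
  have h5 := five_ninths_le_cohenLenstraConst hp
  have h1 := cohenLenstraConst_le_one (p := p) (by omega)
  have hpos : 0 < cohenLenstraConst p := by linarith
  refine ⟨ENNReal.ofReal ((cohenLenstraConst p)⁻¹ - 1), ?_, ?_⟩
  · rw [ENNReal.ofReal_lt_one, sub_lt_iff_lt_add, inv_lt_comm₀ hpos (by norm_num)]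
    linarith
  · rw [← ENNReal.ofReal_one, ← ENNReal.ofReal_add zero_le_one
      (sub_nonneg.2 ((one_le_inv₀ hpos).2 h1)), add_sub_cancel, ENNReal.ofReal_inv_of_pos hpos]

theorem lemma1p2 (p : ℕ) (hp : p.Prime) (hp_odd : Odd p)
    (ν : MeasureTheory.Measure (PointedFinAbPGroup.IsoClass p))
    (hν : ∀ X : PointedFinAbPGroup.IsoClass p,
      pointedMoment ν X.rep = (Nat.card X.rep.carrier : ENNReal)⁻¹) :
    ν = pointedCohenLenstraMeasure p := by
  have hp3 : 3 ≤ p := by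
    have := hp.two_le
    obtain ⟨k, rfl⟩ := hp_odd
    omega
  obtain ⟨r, hr, hc⟩ := inv_cohenLenstraConst_eq_one_add hp3
  have hcpos : 0 < cohenLenstraConst p := by linarith [five_ninths_le_cohenLenstraConst hp3]
  refine Measure.ext_of_singleton fun Y => congrFun (eq_of_tsum_eq_of_diag_dominant
    (s := fun Y X => (Nat.card (Y.rep.Sur X.rep) : ℝ≥0∞))
    (u := fun Y => (Nat.card Y.rep.carrier : ℝ≥0∞)⁻¹ * (Nat.card (Y.rep.Sur Y.rep) : ℝ≥0∞)⁻¹)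
    (v := fun Y => ν {Y}) (w := fun Y => pointedCohenLenstraMeasure p {Y})
    (m := fun Y => (Nat.card Y.rep.carrier : ℝ≥0∞)⁻¹) hν (fun X => ?_) (fun X => ?_)
    (fun X => ?_) (fun X => ?_) (fun X => ?_) (fun X => ?_) hr) Y
  -- The pointed Cohen–Lenstra measure is `c * u`, so its moments are `c` times the row sums of `u`,
  -- and `c` cancels.
  · simp_rw [pointedCohenLenstraMeasure_singleton, mul_left_comm _ (ENNReal.ofReal _)]
    rw [ENNReal.tsum_mul_left, tsum_card_sur_div hp, mul_left_comm,
      ENNReal.mul_inv_cancel (by simpa using hcpos) ENNReal.ofReal_ne_top, mul_one]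
  · rw [tsum_card_sur_div hp, hc]
  · rw [mul_left_comm, card_mul_inv_card, mul_one]
  · simpa using Nat.card_pos.ne'
  · simpa using Nat.card_pos.ne'
  · exact ENNReal.natCast_ne_top _
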